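/- Let $A$ be a (not necessarily unital) $C^*$-algebra. Let $\mathrm{T}(A)$ be the ordered cone (pointwise operations and order) of lower semicontinuous traces $\tau\colon A_+\to[0,\infty]$, i.e. norm-lower semicontinuous maps that are additive, satisfy $\tau(0)=0$, are homogeneous for positive reals, and satisfy $\tau(xx^*)=\tau(x^*x)$ for all $x\in A$. Equip $\mathrm{T}(A)$ with the topology in which $\tau_i\to\tau$ if and only if $\limsup_i\tau_i((a-\varepsilon)_+)\le\tau(a)\le\liminf_i\tau_i(a)$ for all $a\in A_+$ and $\varepsilon>0$. For a closed two-sided ideal $I$ of $A$, let $\tau_I\in\mathrm{T}(A)$ be the trace with value $0$ on $I_+$ and $\infty$ on $A_+\setminus I$, and let $$\mathrm{T}_I(A)=\{\tau\in\mathrm{T}(A)\mid \sup\{e\in\mathrm{T}(A)\mid 2e=e\le\tau\}=\tau_I\}.$$ Let $\mathrm{Ped}(I)$ be the smallest dense (not necessarily closed) two-sided ideal of the $C^*$-algebra $I$. A lower semicontinuous cone morphism $g\colon\mathrm{T}(A)\to[0,\infty]$ is said to have support ideal $I$ if the infimum of all idempotent lower semicontinuous cone morphisms $e\ge g$ on $\mathrm{T}(A)$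 is $f_I$, where $f_I(\tau)=0$ if $\tau\le\tau_I$ and $f_I(\tau)=\infty$ otherwise. For $a\in A_+$ let $\overline{a}\colon\mathrm{T}(A)\to[0,\infty]$, $\overline a(\tau)=\tau(a)$, and let $I=I_a$ be the closed two-sided ideal of $A$ generated by $a$. Assume that $a\in\mathrm{Ped}(I_a)$. Then: (1) The restriction $f:=\overline{a}|_{\mathrm{T}_{I}(A)}\colon\mathrm{T}_{I}(A)\to[0,\infty]$ is continuous, takes values in $[0,\infty)$, and $f^{-1}(\{0\})=\{\tau_{I}\}$. (2) Define $\tilde f\colon\mathrm{T}(A)\to[0,\infty]$ by $\tilde f(\tau)=f(\tau+\tau_{I})$ if $\tau+\tau_{I}\in\mathrm{T}_{I}(A)$, and $\tilde f(\tau)=\infty$ otherwise. Then $\tilde f=\overline{a}$. Moreover $\overline a$ is a continuous cone morphism on $\mathrm{T}(A)$ with support ideal $I$, and it is the only continuous cone morphism $\mathrm{T}(A)\to[0,\infty]$ with support ideal $I$ that extends $f$. -/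

import Mathlib

open scoped ENNReal NNReal Topology

noncomputable section

namespace TraceCone

universe u

variable {A : Type u} [NonUnitalCStarAlgebra A] [PartialOrder A] [StarOrderedRing A]

/-! ### Positive elements and cut-downs -/

/-- The positive cone `A₊` of a C*-algebra. -/
abbrev Pos (A : Type u) [NonUnitalCStarAlgebra A] [PartialOrder A] : Type u := {a : A // 0 ≤ a}

/-- The cut-down `(a - ε)₊`, i.e. the function `t ↦ max (t - ε) 0` applied to `a` by the
(non-unital) continuous functional calculus. It is used for `ε ≥ 0` only. -/
def cutDown (a : Pos A) (ε : ℝ) : Pos A :=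
  ⟨cfcₙ (fun t : ℝ => max (t - ε) 0) (a : A), cfcₙ_nonneg fun _ _ => le_max_right _ _⟩

/-! ### Lower semicontinuous traces -/

variable (A) in
/-- A lower semicontinuous trace on `A`: a map `τ : A₊ → [0,∞]` which is additive, compatible with
multiplication by positive reals, vanishes at `0`, satisfies `τ (x x*) = τ (x* x)`, and is lower
semicontinuous for the norm topology. -/
structure LscTrace where
  toFun : Pos A → ℝ≥0∞
  map_zero' : toFun 0 = 0
  map_add' : ∀ a b : Pos A, toFun (a + b) = toFun a + toFun b
  map_smul' : ∀ (r : ℝ≥0) (a : Pos A), 0 < r →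
    toFun ⟨(r : ℝ) • (a : A), smul_nonneg r.2 a.2⟩ = r * toFun a
  trace' : ∀ x : A, toFun ⟨x * star x, mul_star_self_nonneg x⟩ =
    toFun ⟨star x * x, star_mul_self_nonneg x⟩
  lsc' : LowerSemicontinuous toFun

namespace LscTrace

instance : CoeFun (LscTrace A) fun _ => Pos A → ℝ≥0∞ := ⟨LscTrace.toFun⟩

@[ext] theorem ext {σ τ : LscTrace A} (h : ∀ a, σ a = τ a) : σ = τ := by
  cases σ; cases τ; congr; funext a; exact h a

/-- The pointwise order on traces. -/
instance : PartialOrder (LscTrace A) where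
  le σ τ := ∀ a, σ a ≤ τ a
  le_refl _ _ := le_rfl
  le_trans _ _ _ h h' a := (h a).trans (h' a)
  le_antisymm _ _ h h' := ext fun a => le_antisymm (h a) (h' a)

instance : Zero (LscTrace A) where
  zero :=
    { toFun := fun _ => 0
      map_zero' := rfl
      map_add' := by simp
      map_smul' := by simp
      trace' := by simp
      lsc' := lowerSemicontinuous_const }

instance : Add (LscTrace A) where
  add σ τ :=
    { toFun := fun a => σ a + τ a
      map_zero' := by simp [σ.map_zero', τ.map_zero']
      map_add' := fun a b => by rw [σ.map_add', τ.map_add']; ring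
      map_smul' := fun r a hr => by rw [σ.map_smul' r a hr, τ.map_smul' r a hr]; ring
      trace' := fun x => by rw [σ.trace', τ.trace']
      lsc' := σ.lsc'.add τ.lsc' }

instance : SMul ℝ≥0 (LscTrace A) where
  smul r τ :=
    { toFun := fun a => r * τ a
      map_zero' := by simp [τ.map_zero']
      map_add' := fun a b => by rw [τ.map_add']; ring
      map_smul' := fun s a hs => by rw [τ.map_smul' s a hs]; ring
      trace' := fun x => by rw [τ.trace']
      lsc' := (ENNReal.continuous_const_mul ENNReal.coe_ne_top).comp_lowerSemicontinuous τ.lsc'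
        (fun _ _ h => mul_le_mul_right h _) }

theorem zero_apply (a : Pos A) : (0 : LscTrace A) a = 0 := rfl
theorem add_apply (σ τ : LscTrace A) (a : Pos A) : (σ + τ) a = σ a + τ a := rfl
theorem smul_apply (r : ℝ≥0) (τ : LscTrace A) (a : Pos A) : (r • τ) a = r * τ a := rfl

theorem mono (τ : LscTrace A) {a b : Pos A} (h : (a : A) ≤ b) : τ a ≤ τ b := by
  have : b = a + ⟨(b : A) - a, sub_nonneg.2 h⟩ := Subtype.ext (by simp)
  rw [this, τ.map_add']
  exact le_self_add

end LscTrace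

/-! ### The topology on the cone of traces -/

/-- The interval topology on the cone of lower semicontinuous traces. The theorem
`tendsto_interval_iff` below shows that it is the topology in which `τᵢ → τ` if and only if
`limsup τᵢ ((a - ε)₊) ≤ τ a ≤ liminf τᵢ a` for all `a ∈ A₊` and all `ε > 0`. -/
instance : TopologicalSpace (LscTrace A) :=
  TopologicalSpace.generateFrom
    ({U | ∃ (a : Pos A) (r : ℝ≥0∞), U = {τ : LscTrace A | r < τ a}} ∪
     {U | ∃ (a : Pos A) (ε : ℝ) (r : ℝ≥0∞),
        U = {τ : LscTrace A | ∃ δ : ℝ, 0 < δ ∧ δ < ε ∧ τ (cutDown a δ) < r}})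

theorem cutDown_le_cutDown (a : Pos A) {δ ε : ℝ} (h0 : 0 ≤ δ) (h : δ ≤ ε) :
    (cutDown a ε : A) ≤ cutDown a δ := by
  refine cfcₙ_mono (fun x _ => max_le_max (by linarith) le_rfl) ?_ ?_ ?_ ?_
  · fun_prop
  · fun_prop
  · simpa using h0.trans h
  · simpa using h0

theorem cutDown_le (a : Pos A) {ε : ℝ} (h0 : 0 ≤ ε) : (cutDown a ε : A) ≤ a := by
  conv_rhs => rw [← cfcₙ_id ℝ (a : A) (IsSelfAdjoint.of_nonneg a.2)]
  refine cfcₙ_mono (fun x hx => ?_) ?_ ?_ ?_ ?_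
  · exact max_le (by simpa using h0) (quasispectrum_nonneg_of_nonneg _ a.2 x hx)
  · fun_prop
  · fun_prop
  · simpa using h0
  · simp

theorem cutDown_cutDown (a : Pos A) {δ ε : ℝ} (h0 : 0 ≤ δ) (h1 : 0 ≤ ε) :
    cutDown (cutDown a δ) ε = cutDown a (δ + ε) := by
  apply Subtype.ext
  change cfcₙ (fun t : ℝ => max (t - ε) 0) (cfcₙ (fun t : ℝ => max (t - δ) 0) (a : A)) =
    cfcₙ (fun t : ℝ => max (t - (δ + ε)) 0) (a : A)
  rw [← cfcₙ_comp' (fun t : ℝ => max (t - ε) 0) (fun t : ℝ => max (t - δ) 0) (a : A)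
    (by fun_prop) (by simpa using h1) (by fun_prop) (by simpa using h0)
    (IsSelfAdjoint.of_nonneg a.2)]
  congr 1
  funext t
  grind

theorem tendsto_interval_iff {ι : Type*} {l : Filter ι} {σ : ι → LscTrace A} {τ : LscTrace A} :
    Filter.Tendsto σ l (𝓝 τ) ↔ ∀ (a : Pos A) (ε : ℝ), 0 < ε →
      Filter.limsup (fun i => σ i (cutDown a ε)) l ≤ τ a ∧
        τ a ≤ Filter.liminf (fun i => σ i a) l := by
  rw [TopologicalSpace.tendsto_nhds_generateFrom_iff]
  constructor
  · intro h a ε hε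
    constructor
    · refine le_of_forall_gt_imp_ge_of_dense fun r hr => ?_
      have := h _ (Or.inr ⟨a, ε, r, rfl⟩) ⟨ε / 2, by linarith, by linarith,
        (τ.mono (cutDown_le a (by linarith))).trans_lt hr⟩
      refine Filter.limsup_le_of_le (by isBoundedDefault) ?_
      filter_upwards [this] with i hi
      obtain ⟨δ, h0, h1, h2⟩ := hi
      exact ((σ i).mono (cutDown_le_cutDown a h0.le h1.le)).trans h2.le
    · refine le_of_forall_lt_imp_le_of_dense fun r hr => ?_
      have := h _ (Or.inl ⟨a, r, rfl⟩) hr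
      refine Filter.le_liminf_of_le (by isBoundedDefault) ?_
      filter_upwards [this] with i hi using le_of_lt hi
  · rintro h U (⟨a, r, rfl⟩ | ⟨a, ε, r, rfl⟩) hτ
    · exact Filter.eventually_lt_of_lt_liminf (lt_of_lt_of_le hτ (h a 1 one_pos).2)
    · obtain ⟨δ, h0, h1, h2⟩ := hτ
      have := (h (cutDown a δ) ((ε - δ) / 2) (by linarith)).1.trans_lt h2
      filter_upwards [Filter.eventually_lt_of_limsup_lt this] with i hi
      rw [cutDown_cutDown a h0.le (by linarith)] at hi
      exact ⟨δ + (ε - δ) / 2, by linarith, by linarith, hi⟩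

/-! ### Closed two-sided ideals and Pedersen ideals -/

variable (A) in
/-- A closed two-sided ideal of `A`. -/
structure ClosedIdeal extends Submodule ℂ A where
  mul_mem_left' : ∀ x y : A, y ∈ carrier → x * y ∈ carrier
  mul_mem_right' : ∀ x y : A, x ∈ carrier → x * y ∈ carrier
  isClosed' : IsClosed carrier

namespace ClosedIdeal

instance : Membership A (ClosedIdeal A) := ⟨fun I x => x ∈ I.toSubmodule⟩

theorem mul_mem_left (I : ClosedIdeal A) (x : A) {y : A} (hy : y ∈ I) : x * y ∈ I :=
  I.mul_mem_left' x y hy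

theorem mul_mem_right (I : ClosedIdeal A) {x : A} (y : A) (hx : x ∈ I) : x * y ∈ I :=
  I.mul_mem_right' x y hx

theorem zero_mem (I : ClosedIdeal A) : (0 : A) ∈ I := I.toSubmodule.zero_mem

theorem add_mem (I : ClosedIdeal A) {x y : A} (hx : x ∈ I) (hy : y ∈ I) : x + y ∈ I :=
  I.toSubmodule.add_mem hx hy

theorem smul_mem (I : ClosedIdeal A) (r : ℝ) {x : A} (hx : x ∈ I) : r • x ∈ I := by
  have := I.toSubmodule.smul_mem (r : ℂ) hx
  rwa [Complex.coe_smul] at this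

theorem isClosed (I : ClosedIdeal A) : IsClosed {x : A | x ∈ I} := I.isClosed'

/-- The closed two-sided ideal generated by `a`: the intersection of all closed two-sided ideals
that contain `a`. -/
def generatedBy (a : A) : ClosedIdeal A where
  toSubmodule := sInf {J | ∃ I : ClosedIdeal A, a ∈ I ∧ J = I.toSubmodule}
  mul_mem_left' x y hy := by
    simp only [AddSubsemigroup.mem_carrier, AddSubmonoid.mem_toSubsemigroup,
      Submodule.mem_toAddSubmonoid, Submodule.mem_sInf] at hy ⊢
    rintro J ⟨I, hI, rfl⟩
    exact I.mul_mem_left x (hy _ ⟨I, hI, rfl⟩)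
  mul_mem_right' x y hx := by
    simp only [AddSubsemigroup.mem_carrier, AddSubmonoid.mem_toSubsemigroup,
      Submodule.mem_toAddSubmonoid, Submodule.mem_sInf] at hx ⊢
    rintro J ⟨I, hI, rfl⟩
    exact I.mul_mem_right y (hx _ ⟨I, hI, rfl⟩)
  isClosed' := by
    change IsClosed ((sInf {J | ∃ I : ClosedIdeal A, a ∈ I ∧ J = I.toSubmodule} :
      Submodule ℂ A) : Set A)
    rw [Submodule.coe_sInf]
    refine isClosed_biInter ?_
    rintro J ⟨I, -, rfl⟩
    exact I.isClosed'

/-- The Pedersen ideal `Ped(I)` of a closed two-sided ideal `I`, regarded as a C*-algebra: the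
smallest dense (not necessarily closed) two-sided ideal of `I`, i.e. the intersection of all linear
subspaces `J` of `I` that are dense in `I` and stable under multiplication by elements of `I` from
either side. -/
def pedersen (I : ClosedIdeal A) : Submodule ℂ A :=
  sInf {J | J ≤ I.toSubmodule ∧ (I.toSubmodule : Set A) ⊆ closure (J : Set A) ∧
    ∀ x ∈ I, ∀ y ∈ J, x * y ∈ J ∧ y * x ∈ J}

/-- If `b ∈ I` is positive and `x x* ≤ b`, then `x ∈ I`. -/
theorem mem_of_mul_star_self_le (I : ClosedIdeal A) {b x : A} (hb : b ∈ I)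
    (h : x * star x ≤ b) : x ∈ I := by
  have hb0 : 0 ≤ b := (mul_star_self_nonneg x).trans h
  have hsa : IsSelfAdjoint b := .of_nonneg hb0
  have key : ∀ ε : ℝ, 0 < ε → ∃ u ∈ I, ‖x - u * x‖ * ‖x - u * x‖ ≤ ε := by
    intro ε hε
    have hcont : Continuous fun t : ℝ => t / (t ^ 2 + ε ^ 2) :=
      continuous_id.div (by fun_prop) fun t => by positivity
    set k := cfcₙ (fun t : ℝ => t / (t ^ 2 + ε ^ 2)) b with hk
    have hu : b * k = cfcₙ (fun t : ℝ => t * (t / (t ^ 2 + ε ^ 2))) b := by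
      rw [cfcₙ_mul (fun t : ℝ => t) _ b (by fun_prop) (by simp) hcont.continuousOn (by simp),
        cfcₙ_id' ℝ b hsa]
    have husa : star (b * k) = b * k := by
      rw [hu]; exact (cfcₙ_predicate _ b : IsSelfAdjoint _).star_eq
    refine ⟨b * k, I.mul_mem_right k hb, ?_⟩
    set u := b * k with hudef
    have conj : ∀ y : A, (y - u * y) * star (y - u * y) =
        y * star y - u * (y * star y) - y * star y * u + u * (y * star y) * u := by
      intro y
      rw [star_sub, star_mul, husa]
      noncomm_ring
    have hle : (x - u * x) * star (x - u * x) ≤ b - u * b - b * u + u * b * u := by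
      rw [conj]
      obtain ⟨y, hy⟩ := CStarAlgebra.nonneg_iff_eq_mul_star_self.1 (sub_nonneg.2 h)
      have := mul_star_self_nonneg (y - u * y)
      rw [conj, ← hy] at this
      rw [← sub_nonneg]
      convert this using 1
      noncomm_ring
    have hcfc : b - u * b - b * u + u * b * u =
        cfcₙ (fun t : ℝ => t - t * (t / (t ^ 2 + ε ^ 2)) * t - t * (t * (t / (t ^ 2 + ε ^ 2)))
          + t * (t / (t ^ 2 + ε ^ 2)) * t * (t * (t / (t ^ 2 + ε ^ 2)))) b := by
      have hb' : b = cfcₙ (fun t : ℝ => t) b := (cfcₙ_id' ℝ b hsa).symm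
      rw [hu]
      conv_lhs => rw [hb']
      simp only [cfcₙ_id' ℝ b hsa]
      rw [cfcₙ_add (fun t : ℝ => t - t * (t / (t ^ 2 + ε ^ 2)) * t
          - t * (t * (t / (t ^ 2 + ε ^ 2)))) _ b (by fun_prop) (by simp) (by fun_prop) (by simp),
        cfcₙ_sub (fun t : ℝ => t - t * (t / (t ^ 2 + ε ^ 2)) * t) _ b
          (by fun_prop) (by simp) (by fun_prop) (by simp),
        cfcₙ_sub (fun t : ℝ => t) _ b (by fun_prop) (by simp) (by fun_prop) (by simp),
        cfcₙ_mul (fun t : ℝ => t * (t / (t ^ 2 + ε ^ 2)) * t) _ b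
          (by fun_prop) (by simp) (by fun_prop) (by simp),
        cfcₙ_mul (fun t : ℝ => t * (t / (t ^ 2 + ε ^ 2))) (fun t : ℝ => t) b
          (by fun_prop) (by simp) (by fun_prop) (by simp),
        cfcₙ_mul (fun t : ℝ => t) (fun t : ℝ => t * (t / (t ^ 2 + ε ^ 2))) b
          (by fun_prop) (by simp) (by fun_prop) (by simp),
        cfcₙ_id' ℝ b hsa]
    rw [← CStarRing.norm_self_mul_star]
    refine (CStarAlgebra.norm_le_norm_of_nonneg_of_le (mul_star_self_nonneg _) hle).trans ?_
    rw [hcfc]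
    refine norm_cfcₙ_le fun t ht => ?_
    have ht0 : 0 ≤ t := quasispectrum_nonneg_of_nonneg _ hb0 t ht
    have : t - t * (t / (t ^ 2 + ε ^ 2)) * t - t * (t * (t / (t ^ 2 + ε ^ 2)))
          + t * (t / (t ^ 2 + ε ^ 2)) * t * (t * (t / (t ^ 2 + ε ^ 2)))
        = t * ε ^ 4 / (t ^ 2 + ε ^ 2) ^ 2 := by
      field_simp; ring
    rw [this, Real.norm_of_nonneg (by positivity), div_le_iff₀ (by positivity)]
    have h1 : t * ε ≤ t ^ 2 + ε ^ 2 := by nlinarith [sq_nonneg (t - ε)]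
    have h2 : ε ^ 2 ≤ t ^ 2 + ε ^ 2 := by nlinarith
    calc t * ε ^ 4 = ε * ((t * ε) * ε ^ 2) := by ring
      _ ≤ ε * ((t ^ 2 + ε ^ 2) * (t ^ 2 + ε ^ 2)) := by gcongr
      _ = _ := by ring
  have : x ∈ closure {y : A | y ∈ I} := by
    rw [Metric.mem_closure_iff]
    intro δ hδ
    obtain ⟨u, hu, hux⟩ := key ((δ / 2) ^ 2) (by positivity)
    refine ⟨u * x, I.mul_mem_right x hu, ?_⟩
    rw [dist_eq_norm]
    have := abs_le_of_sq_le_sq' (by simpa [sq] using hux) (by positivity : 0 ≤ δ / 2)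
    linarith [this.2]
  rwa [I.isClosed.closure_eq] at this

/-- Closed two-sided ideals are hereditary. -/
theorem mem_of_le (I : ClosedIdeal A) {a b : A} (ha : 0 ≤ a) (hb : b ∈ I) (h : a ≤ b) :
    a ∈ I := by
  obtain ⟨x, rfl⟩ := CStarAlgebra.nonneg_iff_eq_mul_star_self.1 ha
  exact I.mul_mem_right _ (I.mem_of_mul_star_self_le hb h)

end ClosedIdeal

/-! ### The traces attached to ideals -/

open Classical in
/-- The trace `τ_I`, with value `0` on `I` and `∞` elsewhere. -/
def idealTrace (I : ClosedIdeal A) : LscTrace A where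
  toFun a := if (a : A) ∈ I then 0 else ⊤
  map_zero' := if_pos I.zero_mem
  map_add' a b := by
    by_cases ha : (a : A) ∈ I <;> by_cases hb : (b : A) ∈ I
    · have : ((a + b : Pos A) : A) ∈ I := I.add_mem ha hb
      simp only [if_pos this, if_pos ha, if_pos hb, add_zero]
    · have : ((a + b : Pos A) : A) ∉ I := fun h =>
        hb (I.mem_of_le b.2 h (le_add_of_nonneg_left a.2))
      simp only [if_neg this, if_neg hb, add_top]
    · have : ((a + b : Pos A) : A) ∉ I := fun h =>
        ha (I.mem_of_le a.2 h (le_add_of_nonneg_right b.2))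
      simp only [if_neg this, if_neg ha, top_add]
    · have : ((a + b : Pos A) : A) ∉ I := fun h =>
        ha (I.mem_of_le a.2 h (le_add_of_nonneg_right b.2))
      simp only [if_neg this, if_neg ha, top_add]
  map_smul' r a hr := by
    by_cases ha : (a : A) ∈ I
    · simp only [if_pos ha, if_pos (I.smul_mem (r : ℝ) ha), mul_zero]
    · have : (r : ℝ) • (a : A) ∉ I := fun h => ha (by
        have := I.smul_mem (r : ℝ)⁻¹ h
        rwa [smul_smul, inv_mul_cancel₀ (by exact_mod_cast hr.ne'), one_smul] at this)
      simp only [if_neg ha, if_neg this]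
      rw [ENNReal.mul_top (by exact_mod_cast hr.ne')]
  trace' x := by
    have h1 : x * star x ∈ I ↔ x ∈ I :=
      ⟨fun h => I.mem_of_mul_star_self_le h le_rfl, fun h => I.mul_mem_right _ h⟩
    have h2 : star x * x ∈ I ↔ x ∈ I := by
      refine ⟨fun h => ?_, fun h => I.mul_mem_left _ h⟩
      have : star x ∈ I := I.mem_of_mul_star_self_le h (by rw [star_star])
      exact h1.1 (I.mul_mem_left _ this)
    simp only [h1, h2]
  lsc' := by
    intro a r hr
    dsimp only at hr
    split_ifs at hr with ha
    · exact absurd hr not_lt_zero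
    · have hopen : IsOpen {b : Pos A | (b : A) ∉ I} :=
        (I.isClosed.preimage continuous_subtype_val).isOpen_compl
      filter_upwards [hopen.mem_nhds ha] with b hb
      have hb' : (b : A) ∉ I := hb
      simpa only [if_neg hb'] using hr

theorem idealTrace_of_mem {I : ClosedIdeal A} {a : Pos A} (h : (a : A) ∈ I) :
    idealTrace I a = 0 := if_pos h

theorem idealTrace_of_notMem {I : ClosedIdeal A} {a : Pos A} (h : (a : A) ∉ I) :
    idealTrace I a = ⊤ := if_neg h

theorem idealTrace_add_self (I : ClosedIdeal A) : idealTrace I + idealTrace I = idealTrace I := by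
  ext a
  rw [LscTrace.add_apply]
  by_cases h : (a : A) ∈ I
  · simp [idealTrace_of_mem h]
  · simp [idealTrace_of_notMem h]

/-- The subcone `T_I(A)` of all traces `τ` with support idempotent `τ_I`, the support idempotent
of `τ` being the supremum in `T(A)` of all idempotents `e ≤ τ`. -/
def supportCone (I : ClosedIdeal A) : Set (LscTrace A) :=
  {τ | IsLUB {e : LscTrace A | e + e = e ∧ e ≤ τ} (idealTrace I)}

theorem idealTrace_mem_supportCone (I : ClosedIdeal A) : idealTrace I ∈ supportCone I :=
  ⟨fun _ he => he.2, fun _ h => h ⟨idealTrace_add_self I, le_rfl⟩⟩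

/-! ### Lower semicontinuous and continuous functionals on the cone of traces -/

variable (A) in
/-- `Lsc_C(T(A))`: the lower semicontinuous cone morphisms `T(A) → [0,∞]`. -/
structure LscFunctional where
  toFun : LscTrace A → ℝ≥0∞
  map_zero' : toFun 0 = 0
  map_add' : ∀ σ τ : LscTrace A, toFun (σ + τ) = toFun σ + toFun τ
  map_smul' : ∀ (r : ℝ≥0) (τ : LscTrace A), 0 < r → toFun (r • τ) = r * toFun τ
  lsc' : LowerSemicontinuous toFun

namespace LscFunctional

instance : CoeFun (LscFunctional A) fun _ => LscTrace A → ℝ≥0∞ := ⟨LscFunctional.toFun⟩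

@[ext] theorem ext {f g : LscFunctional A} (h : ∀ τ, f τ = g τ) : f = g := by
  cases f; cases g; congr; funext τ; exact h τ

/-- The pointwise order on functionals. -/
instance : PartialOrder (LscFunctional A) where
  le f g := ∀ τ, f τ ≤ g τ
  le_refl _ _ := le_rfl
  le_trans _ _ _ h h' τ := (h τ).trans (h' τ)
  le_antisymm _ _ h h' := ext fun τ => le_antisymm (h τ) (h' τ)

end LscFunctional

theorem isOpen_lt_apply (a : Pos A) (r : ℝ≥0∞) : IsOpen {τ : LscTrace A | r < τ a} :=
  TopologicalSpace.isOpen_generateFrom_of_mem (Or.inl ⟨a, r, rfl⟩)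

/-- The evaluation functional `ā : T(A) → [0,∞]`, `τ ↦ τ a`. -/
def evalFunctional (a : Pos A) : LscFunctional A where
  toFun τ := τ a
  map_zero' := rfl
  map_add' _ _ := rfl
  map_smul' _ _ _ := rfl
  lsc' := lowerSemicontinuous_iff_isOpen_preimage.2 fun r => isOpen_lt_apply a r

theorem le_idealTrace_iff {I : ClosedIdeal A} {τ : LscTrace A} :
    τ ≤ idealTrace I ↔ ∀ a : Pos A, (a : A) ∈ I → τ a = 0 := by
  refine ⟨fun h a ha => ?_, fun h a => ?_⟩
  · have := h a
    rwa [idealTrace_of_mem ha, nonpos_iff_eq_zero] at this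
  · by_cases ha : (a : A) ∈ I
    · rw [h a ha]; exact zero_le
    · rw [idealTrace_of_notMem ha]; exact le_top

open Classical in
/-- The idempotent functional `f_I`, with value `0` at the traces `τ ≤ τ_I` and `∞` elsewhere. -/
def idealFunctional (I : ClosedIdeal A) : LscFunctional A where
  toFun τ := if τ ≤ idealTrace I then 0 else ⊤
  map_zero' := if_pos fun _ => zero_le
  map_add' σ τ := by
    have : σ + τ ≤ idealTrace I ↔ σ ≤ idealTrace I ∧ τ ≤ idealTrace I := by
      simp only [le_idealTrace_iff, LscTrace.add_apply, add_eq_zero]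
      exact ⟨fun h => ⟨fun a ha => (h a ha).1, fun a ha => (h a ha).2⟩,
        fun h a ha => ⟨h.1 a ha, h.2 a ha⟩⟩
    by_cases h1 : σ ≤ idealTrace I <;> by_cases h2 : τ ≤ idealTrace I <;> simp [this, h1, h2]
  map_smul' r τ hr := by
    have : r • τ ≤ idealTrace I ↔ τ ≤ idealTrace I := by
      simp only [le_idealTrace_iff, LscTrace.smul_apply, mul_eq_zero, ENNReal.coe_eq_zero, hr.ne',
        false_or]
    by_cases h : τ ≤ idealTrace I
    · simp [this, h]
    · simp only [this, if_neg h]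
      rw [ENNReal.mul_top (by exact_mod_cast hr.ne')]
  lsc' := by
    intro τ r hr
    dsimp only at hr
    split_ifs at hr with h
    · exact absurd hr not_lt_zero
    · simp only [le_idealTrace_iff, not_forall] at h
      obtain ⟨a, ha, h0⟩ := h
      filter_upwards [(isOpen_lt_apply a 0).mem_nhds (pos_iff_ne_zero.2 h0)] with σ hσ
      have : ¬ σ ≤ idealTrace I := fun h' => (ne_of_gt hσ) (le_idealTrace_iff.1 h' a ha)
      simpa only [if_neg this] using hr

/-- `g` has support ideal `I`: the infimum in `Lsc_C(T(A))` of all idempotents `e ≥ g` is `f_I`. -/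
def LscFunctional.HasSupportIdeal (g : LscFunctional A) (I : ClosedIdeal A) : Prop :=
  IsGLB {e : LscFunctional A | (∀ τ, e τ + e τ = e τ) ∧ g ≤ e} (idealFunctional I)

open Classical in
/-- The extension `f̃` to `T(A)` of a function `f` on `T_I(A)`: it sends `τ` to `f (τ + τ_I)` if
`τ + τ_I` belongs to `T_I(A)`, and to `∞` otherwise. -/
def extend (I : ClosedIdeal A) (f : supportCone I → ℝ≥0∞) (τ : LscTrace A) : ℝ≥0∞ :=
  if h : τ + idealTrace I ∈ supportCone I then f ⟨τ + idealTrace I, h⟩ else ⊤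

end TraceCone

end

open TraceCone


/-!
If `a ∈ Ped(I_a)`, then the dimension function of every trace satisfies
`d_τ(a) ≤ C τ((a - ε)₊)` with `C` and `ε > 0` independent of `τ`: the positive elements with this
property form a hereditary cone whose span is a dense ideal of `I_a`. As `min(a, δ)` has norm at
most `δ`, it follows that `τ(a) ≤ (1 + C δ) τ((a - δ)₊)` for `δ ≤ ε`, and `ā` is continuous.

If `g` is a continuous functional, then `g(τ) < ∞` if and only if `g` vanishes at the support
idempotent of `τ`, because `n⁻¹ τ` converges to this idempotent. When `g` has support ideal `I`,
this means that either `g(τ) = ∞` or `τ + τ_I ∈ T_I(A)` with `g(τ) = g(τ + τ_I)`, so `g` is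
determined by its restriction to `T_I(A)`.
-/

noncomputable section

namespace TraceCone

variable {A : Type*} [NonUnitalCStarAlgebra A] [PartialOrder A] [StarOrderedRing A]

/-- The positive element `|x|² = x* x`. Since every positive element is of this form and
`τ (x* x) = τ (x x*)`, it is used to turn estimates on either side of a product into each other. -/
def absSq (x : A) : Pos A := ⟨star x * x, star_mul_self_nonneg x⟩

theorem coe_absSq (x : A) : (absSq x : A) = star x * x := rfl

theorem continuous_absSq : Continuous (absSq : A → Pos A) :=
  (continuous_star.mul continuous_id).subtype_mk _

theorem enorm_absSq (x : A) : ‖(absSq x : A)‖ₑ = ‖x‖ₑ ^ 2 := by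
  simp only [enorm_eq_nnnorm, coe_absSq, CStarRing.nnnorm_star_mul_self, sq, ENNReal.coe_mul]

theorem exists_absSq_eq (b : Pos A) : ∃ x : A, IsSelfAdjoint x ∧ absSq x = b := by
  have hsqrt : IsSelfAdjoint (CFC.sqrt (b : A)) := .of_nonneg (CFC.sqrt_nonneg _)
  refine ⟨CFC.sqrt (b : A), hsqrt, Subtype.ext ?_⟩
  rw [coe_absSq, hsqrt.star_eq, CFC.sqrt_mul_sqrt_self _ b.2]

/-- The compression `x* b x` of a positive element `b`. -/
def compress (x : A) (b : Pos A) : Pos A := ⟨star x * b * x, star_left_conjugate_nonneg b.2 x⟩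

theorem coe_compress (x : A) (b : Pos A) : (compress x b : A) = star x * b * x := rfl

theorem compress_absSq (x v : A) : compress x (absSq v) = absSq (v * x) :=
  Subtype.ext (by simp only [coe_compress, coe_absSq, star_mul, mul_assoc])

theorem compress_zero (x : A) : compress x (0 : Pos A) = 0 :=
  Subtype.ext (by simp [coe_compress])

theorem compress_add (x : A) (b c : Pos A) : compress x (b + c) = compress x b + compress x c :=
  Subtype.ext (by simp only [coe_compress, Pos, Nonneg.coe_add, mul_add, add_mul])

theorem compress_compress (x y : A) (b : Pos A) :
    compress x (compress y b) = compress (y * x) b :=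
  Subtype.ext (by simp only [coe_compress, star_mul, mul_assoc])

theorem compress_mono (x : A) {b c : Pos A} (h : (b : A) ≤ c) :
    (compress x b : A) ≤ compress x c := star_left_conjugate_le_conjugate h x

namespace LscTrace

variable (τ : LscTrace A)

theorem map_nnreal_smul (r : ℝ≥0) (a : Pos A) :
    τ ⟨(r : ℝ) • (a : A), smul_nonneg r.2 a.2⟩ = r * τ a := by
  rcases eq_zero_or_pos r with rfl | hr
  · have : (⟨((0 : ℝ≥0) : ℝ) • (a : A), smul_nonneg (0 : ℝ≥0).2 a.2⟩ : Pos A) = 0 :=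
      Subtype.ext (by simp)
    rw [this, τ.map_zero', ENNReal.coe_zero, zero_mul]
  · exact τ.map_smul' r a hr

theorem apply_le_of_le_smul {a b : Pos A} (r : ℝ≥0) (h : (a : A) ≤ (r : ℝ) • (b : A)) :
    τ a ≤ r * τ b :=
  (τ.mono h).trans_eq (τ.map_nnreal_smul r b)

theorem map_absSq_star (x : A) : τ (absSq (star x)) = τ (absSq x) := by
  refine (congrArg τ (Subtype.ext ?_)).trans (τ.trace' x)
  rw [coe_absSq, star_star]

theorem map_absSq_mul_left_le (z x : A) : τ (absSq (z * x)) ≤ ‖z‖ₑ ^ 2 * τ (absSq x) := by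
  refine τ.apply_le_of_le_smul (‖z‖₊ ^ 2) ?_
  calc (absSq (z * x) : A) = star x * (star z * z) * x := by
        simp only [coe_absSq, star_mul, mul_assoc]
    _ ≤ ‖star z * z‖ • (star x * x) :=
        CStarAlgebra.star_left_conjugate_le_norm_smul (.star_mul_self z)
    _ = ((‖z‖₊ ^ 2 : ℝ≥0) : ℝ) • (absSq x : A) := by
        rw [CStarRing.norm_star_mul_self, coe_absSq, NNReal.coe_pow, coe_nnnorm, sq]

theorem map_absSq_mul_right_le (x z : A) : τ (absSq (x * z)) ≤ ‖z‖ₑ ^ 2 * τ (absSq x) := by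
  have henorm : ‖star z‖ₑ = ‖z‖ₑ := by simp only [enorm_eq_nnnorm, nnnorm_star]
  rw [← τ.map_absSq_star, ← τ.map_absSq_star x, star_mul, ← henorm]
  exact τ.map_absSq_mul_left_le _ _

theorem map_absSq_add_le (x y : A) :
    τ (absSq (x + y)) ≤ 2 * (τ (absSq x) + τ (absSq y)) := by
  rw [← τ.map_add']
  refine τ.apply_le_of_le_smul 2 ?_
  have parallelogram : star (x + y) * (x + y) + star (x - y) * (x - y) =
      (2 : ℝ) • (star x * x + star y * y) := by
    rw [two_smul, star_add, star_sub]
    noncomm_ring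
  exact (le_add_of_nonneg_right (star_mul_self_nonneg (x - y))).trans_eq parallelogram

theorem map_absSq_smul (c : ℂ) (x : A) : τ (absSq (c • x)) = ‖c‖ₑ ^ 2 * τ (absSq x) := by
  refine Eq.trans (congrArg τ (Subtype.ext ?_)) (τ.map_nnreal_smul (‖c‖₊ ^ 2) _)
  change star (c • x) * (c • x) = ((‖c‖₊ ^ 2 : ℝ≥0) : ℝ) • (star x * x)
  rw [star_smul, smul_mul_smul_comm, ← Complex.coe_smul, Complex.star_def,
    Complex.conj_mul']
  simp

theorem map_absSq_zero : τ (absSq (0 : A)) = 0 := by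
  rw [show absSq (0 : A) = 0 from Subtype.ext (by simp [coe_absSq]), τ.map_zero']

theorem map_compress_le (x : A) (b : Pos A) : τ (compress x b) ≤ ‖x‖ₑ ^ 2 * τ b := by
  obtain ⟨y, -, rfl⟩ := exists_absSq_eq b
  rw [compress_absSq]
  exact τ.map_absSq_mul_right_le y x

/-- The closed ideal of all `x` with `τ (x* x) = 0`. -/
def kernel : ClosedIdeal A where
  carrier := {x | τ (absSq x) = 0}
  zero_mem' := τ.map_absSq_zero
  add_mem' {x y} (hx : τ (absSq x) = 0) (hy : τ (absSq y) = 0) :=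
    le_zero_iff.1 ((τ.map_absSq_add_le x y).trans_eq (by rw [hx, hy, add_zero, mul_zero]))
  smul_mem' c x (hx : τ (absSq x) = 0) := (τ.map_absSq_smul c x).trans (by rw [hx, mul_zero])
  mul_mem_left' x y (hy : τ (absSq y) = 0) :=
    le_zero_iff.1 ((τ.map_absSq_mul_left_le x y).trans_eq (by rw [hy, mul_zero]))
  mul_mem_right' x y (hx : τ (absSq x) = 0) :=
    le_zero_iff.1 ((τ.map_absSq_mul_right_le x y).trans_eq (by rw [hx, mul_zero]))
  isClosed' := by
    simp only [← nonpos_iff_eq_zero]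
    exact (τ.lsc'.isClosed_preimage 0).preimage continuous_absSq

/-- The linear subspace of all `x` with `τ (x* x) < ∞`, which is dense in `finiteIdeal τ`. -/
def squareSummable : Submodule ℂ A where
  carrier := {x | τ (absSq x) < ⊤}
  zero_mem' := by simp [τ.map_absSq_zero]
  add_mem' {x y} hx hy := (τ.map_absSq_add_le x y).trans_lt
    (ENNReal.mul_lt_top ENNReal.ofNat_lt_top (ENNReal.add_lt_top.2 ⟨hx, hy⟩))
  smul_mem' c x hx := (τ.map_absSq_smul c x).trans_lt
    (ENNReal.mul_lt_top (ENNReal.pow_lt_top enorm_lt_top) hx)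

/-- The closed ideal on which `τ` is densely finite. The corresponding trace `τ_I` is the support
idempotent of `τ`. -/
def finiteIdeal : ClosedIdeal A where
  toSubmodule := τ.squareSummable.topologicalClosure
  mul_mem_left' x _ hy := map_mem_closure (continuous_const_mul x) hy fun z hz =>
    (τ.map_absSq_mul_left_le x z).trans_lt
      (ENNReal.mul_lt_top (ENNReal.pow_lt_top enorm_lt_top) hz)
  mul_mem_right' _ y hx := map_mem_closure (f := (· * y)) (continuous_mul_const y) hx fun z hz =>
    (τ.map_absSq_mul_right_le z y).trans_lt
      (ENNReal.mul_lt_top (ENNReal.pow_lt_top enorm_lt_top) hz)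
  isClosed' := τ.squareSummable.isClosed_topologicalClosure

end LscTrace

theorem norm_sub_cutDown_le (a : Pos A) {ε : ℝ} (hε : 0 ≤ ε) :
    ‖(a : A) - cutDown a ε‖ ≤ ε := by
  have : (a : A) - cutDown a ε = cfcₙ (fun t : ℝ => t - max (t - ε) 0) (a : A) := by
    rw [cfcₙ_sub (fun t : ℝ => t) _ (a : A) (by fun_prop) (by simp) (by fun_prop)
      (by simpa using hε), cfcₙ_id' ℝ (a : A) (.of_nonneg a.2)]
    rfl
  rw [this]
  refine norm_cfcₙ_le fun t ht => ?_
  have ht0 : 0 ≤ t := quasispectrum_nonneg_of_nonneg _ a.2 t ht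
  rw [Real.norm_eq_abs, abs_le]
  grind

namespace ClosedIdeal

theorem absSq_mem_iff (I : ClosedIdeal A) {x : A} : (absSq x : A) ∈ I ↔ x ∈ I := by
  refine ⟨fun h => ?_, fun h => I.mul_mem_left _ h⟩
  have hstar : star x ∈ I := I.mem_of_mul_star_self_le h (by rw [star_star, coe_absSq])
  exact I.mem_of_mul_star_self_le (I.mul_mem_left x hstar) le_rfl

theorem mem_generatedBy (a : A) : a ∈ generatedBy a := by
  refine Submodule.mem_sInf.2 ?_
  rintro J ⟨I, hI, rfl⟩
  exact hI

theorem generatedBy_le {a : A} {I : ClosedIdeal A} (h : a ∈ I) {x : A}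
    (hx : x ∈ generatedBy a) : x ∈ I :=
  Submodule.mem_sInf.1 hx _ ⟨I, h, rfl⟩

theorem ext_of_forall_nonneg {I J : ClosedIdeal A}
    (h : ∀ b : Pos A, (b : A) ∈ I ↔ (b : A) ∈ J) : I = J := by
  have : I.toSubmodule = J.toSubmodule := by
    ext x
    exact I.absSq_mem_iff.symm.trans ((h _).trans J.absSq_mem_iff)
  cases I; cases J; congr

theorem cutDown_mem (I : ClosedIdeal A) {a : Pos A} (ha : (a : A) ∈ I) {ε : ℝ} (hε : 0 ≤ ε) :
    (cutDown a ε : A) ∈ I :=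
  I.mem_of_le (cutDown a ε).2 ha (cutDown_le a hε)

theorem mem_of_forall_cutDown_mem (I : ClosedIdeal A) {a : Pos A}
    (h : ∀ ε > 0, (cutDown a ε : A) ∈ I) : (a : A) ∈ I := by
  rw [← Set.mem_ofPred_eq (p := (· ∈ I)), ← I.isClosed.closure_eq, Metric.mem_closure_iff]
  refine fun ε hε => ⟨cutDown a (ε / 2), h _ (half_pos hε), ?_⟩
  rw [dist_eq_norm]
  exact (norm_sub_cutDown_le a (half_pos hε).le).trans_lt (half_lt_self hε)

end ClosedIdeal

theorem idealTrace_le_idealTrace_iff {I J : ClosedIdeal A} :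
    idealTrace I ≤ idealTrace J ↔ ∀ b : Pos A, (b : A) ∈ J → (b : A) ∈ I := by
  rw [le_idealTrace_iff]
  refine forall₂_congr fun b _ => ?_
  by_cases hb : (b : A) ∈ I
  · simp [idealTrace_of_mem hb, hb]
  · simp [idealTrace_of_notMem hb, hb]

theorem idealTrace_injective : Function.Injective (idealTrace : ClosedIdeal A → LscTrace A) :=
  fun _ _ h => ClosedIdeal.ext_of_forall_nonneg fun b =>
    ⟨idealTrace_le_idealTrace_iff.1 h.ge b, idealTrace_le_idealTrace_iff.1 h.le b⟩

theorem eq_zero_or_eq_top_of_add_self_eq {x : ℝ≥0∞} (h : x + x = x) : x = 0 ∨ x = ⊤ := by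
  by_contra! hx
  exact hx.1 ((ENNReal.add_right_inj hx.2).1 (h.trans (add_zero x).symm))

namespace LscTrace

theorem mem_kernel_iff (τ : LscTrace A) (b : Pos A) : (b : A) ∈ τ.kernel ↔ τ b = 0 := by
  obtain ⟨x, -, rfl⟩ := exists_absSq_eq b
  exact τ.kernel.absSq_mem_iff

theorem le_idealTrace_generatedBy_iff {τ : LscTrace A} {a : Pos A} :
    τ ≤ idealTrace (ClosedIdeal.generatedBy (a : A)) ↔ τ a = 0 := by
  rw [le_idealTrace_iff]
  refine ⟨fun h => h a (ClosedIdeal.mem_generatedBy _), fun h b hb => ?_⟩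
  exact (τ.mem_kernel_iff b).1 (ClosedIdeal.generatedBy_le ((τ.mem_kernel_iff a).2 h) hb)

theorem mem_finiteIdeal_of_lt_top {τ : LscTrace A} {b : Pos A} (h : τ b < ⊤) :
    (b : A) ∈ τ.finiteIdeal := by
  obtain ⟨x, -, rfl⟩ := exists_absSq_eq b
  exact τ.finiteIdeal.absSq_mem_iff.2 (subset_closure h)

theorem idealTrace_finiteIdeal_le (τ : LscTrace A) : idealTrace τ.finiteIdeal ≤ τ := by
  intro b
  by_cases h : τ b < ⊤
  · exact (idealTrace_of_mem (mem_finiteIdeal_of_lt_top h)).trans_le zero_le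
  · exact le_top.trans_eq (not_lt_top_iff.1 h).symm

theorem isLUB_idealTrace_finiteIdeal (τ : LscTrace A) :
    IsLUB {e : LscTrace A | e + e = e ∧ e ≤ τ} (idealTrace τ.finiteIdeal) := by
  refine ⟨?_, fun f hf => hf ⟨idealTrace_add_self _, τ.idealTrace_finiteIdeal_le⟩⟩
  rintro e ⟨he, heτ⟩
  refine le_idealTrace_iff.2 fun b hb => (e.mem_kernel_iff b).1 ?_
  refine closure_minimal (t := {x | x ∈ e.kernel}) (fun x hx => ?_) e.kernel.isClosed hb
  have hidem : e (absSq x) + e (absSq x) = e (absSq x) := congrArg (· (absSq x)) he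
  exact (eq_zero_or_eq_top_of_add_self_eq hidem).resolve_right ((heτ _).trans_lt hx).ne

theorem mem_supportCone_iff {τ : LscTrace A} {I : ClosedIdeal A} :
    τ ∈ supportCone I ↔ I = τ.finiteIdeal :=
  ⟨fun h => idealTrace_injective (h.unique τ.isLUB_idealTrace_finiteIdeal),
    fun h => h ▸ τ.isLUB_idealTrace_finiteIdeal⟩

end LscTrace

section FunctionalCalculus

variable {A : Type*} [NonUnitalCStarAlgebra A]

theorem isSelfAdjoint_cfcₙ (f : ℝ → ℝ) (r : A) : IsSelfAdjoint (cfcₙ f r) := cfcₙ_predicate f r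

theorem cfcₙ_mul_mul_cfcₙ (r : A) {f h : ℝ → ℝ} (hf : Continuous f) (hf0 : f 0 = 0)
    (hh : Continuous h) (hh0 : h 0 = 0) :
    cfcₙ f r * cfcₙ h r * cfcₙ f r = cfcₙ (fun t => f t * h t * f t) r := by
  rw [cfcₙ_mul (fun t : ℝ => f t * h t) f r (by fun_prop) (by simp [hf0]) hf.continuousOn hf0,
    cfcₙ_mul f h r hf.continuousOn hf0 hh.continuousOn hh0]

theorem abs_sub_div_sq_mul_le (t : ℝ) {η : ℝ} (hη : 0 < η) :
    |t - (t ^ 2 / (t ^ 2 + η ^ 2)) ^ 2 * t| ≤ η := by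
  have hden : 0 < t ^ 2 + η ^ 2 := by positivity
  set q := t ^ 2 / (t ^ 2 + η ^ 2) with hq
  have hq0 : 0 ≤ q := by positivity
  have hq1 : q ≤ 1 := (div_le_one hden).2 (by nlinarith)
  have hfactor : t - q ^ 2 * t = (1 + q) * (η * (t * η / (t ^ 2 + η ^ 2))) := by
    rw [hq]
    field_simp
    ring
  have hamgm : |t * η / (t ^ 2 + η ^ 2)| ≤ 1 / 2 := by
    rw [abs_div, abs_of_pos hden, div_le_iff₀ hden, abs_le]
    constructor <;> nlinarith [sq_nonneg (t - η), sq_nonneg (t + η)]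
  rw [hfactor, abs_mul, abs_mul, abs_of_pos hη, abs_of_nonneg (add_nonneg zero_le_one hq0)]
  calc (1 + q) * (η * |t * η / (t ^ 2 + η ^ 2)|) ≤ 2 * (η * (1 / 2)) := by
        gcongr
        linarith
    _ = η := by ring

theorem exists_isSelfAdjoint_norm_sub_mul_le {r : A} (hr : IsSelfAdjoint r) {η : ℝ} (hη : 0 < η) :
    ∃ g : A, IsSelfAdjoint g ∧ ‖g * (r * r) * g‖ ≤ 1 ∧ ‖r - g * (r * r) * g * r‖ ≤ η := by
  have hden (t : ℝ) : 0 < t ^ 2 + η ^ 2 := by positivity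
  have hcont : Continuous fun t : ℝ => t / (t ^ 2 + η ^ 2) :=
    continuous_id.div (by fun_prop) fun t => (hden t).ne'
  have hqcont : Continuous fun t : ℝ => (t ^ 2 / (t ^ 2 + η ^ 2)) ^ 2 :=
    ((continuous_id.pow 2).div (by fun_prop) fun t => (hden t).ne').pow 2
  set g := cfcₙ (fun t : ℝ => t / (t ^ 2 + η ^ 2)) r with hg
  have hk : g * (r * r) * g = cfcₙ (fun t => (t ^ 2 / (t ^ 2 + η ^ 2)) ^ 2) r := by
    have hrr : r * r = cfcₙ (fun t : ℝ => t * t) r := by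
      rw [cfcₙ_mul (fun t : ℝ => t) _ r (by fun_prop) rfl (by fun_prop) rfl, cfcₙ_id' ℝ r hr]
    rw [hrr, hg, cfcₙ_mul_mul_cfcₙ r hcont (by simp) (by fun_prop) (by simp)]
    congr 1
    funext t
    ring
  refine ⟨g, isSelfAdjoint_cfcₙ _ r, ?_, ?_⟩
  · rw [hk]
    refine norm_cfcₙ_le fun t _ => ?_
    rw [Real.norm_of_nonneg (by positivity)]
    exact pow_le_one₀ (by positivity) ((div_le_one (hden t)).2 (by nlinarith))
  · have hsub : r - g * (r * r) * g * r =
        cfcₙ (fun t => t - (t ^ 2 / (t ^ 2 + η ^ 2)) ^ 2 * t) r := by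
      rw [hk, cfcₙ_sub (fun t : ℝ => t) _ r (by fun_prop) rfl (by fun_prop) (by simp),
        cfcₙ_mul _ (fun t : ℝ => t) r hqcont.continuousOn (by simp) (by fun_prop) rfl,
        cfcₙ_id' ℝ r hr]
    rw [hsub]
    exact norm_cfcₙ_le fun t _ => abs_sub_div_sq_mul_le t hη

end FunctionalCalculus

theorem norm_sub_mul_le_of_mul_star_le {c r : A} (h : c * star c ≤ r * star r) (k : A) :
    ‖c - k * c‖ ≤ ‖r - k * r‖ := by
  obtain ⟨y, hy⟩ := CStarAlgebra.nonneg_iff_eq_mul_star_self.1 (sub_nonneg.2 h)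
  have expand (z : A) : (z - k * z) * star (z - k * z) =
      z * star z - k * (z * star z) - z * star z * star k + k * (z * star z) * star k := by
    rw [star_sub, star_mul]
    noncomm_ring
  have hle : (c - k * c) * star (c - k * c) ≤ (r - k * r) * star (r - k * r) := by
    rw [← sub_nonneg]
    refine (mul_star_self_nonneg (y - k * y)).trans_eq ?_
    rw [expand, expand, expand, ← hy]
    noncomm_ring
  have := CStarAlgebra.norm_le_norm_of_nonneg_of_le (mul_star_self_nonneg _) hle
  rw [CStarRing.norm_self_mul_star, CStarRing.norm_self_mul_star] at this
  exact abs_le_of_sq_le_sq' (by simpa only [sq] using this) (norm_nonneg _) |>.2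

theorem mem_closure_compress_of_le {b s : Pos A} (h : (b : A) ≤ s) :
    b ∈ closure {p : Pos A | (∃ x, p = compress x s) ∧ ‖(p : A)‖ ≤ ‖(b : A)‖} := by
  obtain ⟨c, hc, rfl⟩ := exists_absSq_eq b
  obtain ⟨r, hr, rfl⟩ := exists_absSq_eq s
  have hcr : c * star c ≤ r * star r := by
    simpa only [coe_absSq, hc.star_eq, hr.star_eq] using h
  refine Metric.mem_closure_iff.2 fun θ hθ => ?_
  obtain ⟨g, hg, hk, hgr⟩ := exists_isSelfAdjoint_norm_sub_mul_le hr
    (η := θ / (‖c‖ + 1)) (by positivity)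
  set k := g * (r * r) * g with hkdef
  have hcomp : (compress (g * c) (absSq r) : A) = c * k * c := by
    simp only [coe_compress, coe_absSq, star_mul, hg.star_eq, hc.star_eq, hr.star_eq, hkdef,
      mul_assoc]
  have hkc : ‖c - k * c‖ ≤ θ / (‖c‖ + 1) := (norm_sub_mul_le_of_mul_star_le hcr k).trans hgr
  refine ⟨compress (g * c) (absSq r), ⟨⟨_, rfl⟩, ?_⟩, ?_⟩
  · rw [hcomp, coe_absSq, CStarRing.norm_star_mul_self]
    calc ‖c * k * c‖ ≤ ‖c‖ * ‖k‖ * ‖c‖ := norm_mul₃_le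
      _ ≤ ‖c‖ * 1 * ‖c‖ := by gcongr
      _ = ‖c‖ * ‖c‖ := by rw [mul_one]
  · have hdiff : (absSq c : A) - compress (g * c) (absSq r) = c * (c - k * c) := by
      rw [hcomp, coe_absSq, hc.star_eq, mul_sub, mul_assoc]
    rw [Subtype.dist_eq, dist_eq_norm, hdiff]
    calc ‖c * (c - k * c)‖ ≤ ‖c‖ * (θ / (‖c‖ + 1)) := norm_mul_le_of_le le_rfl hkc
      _ < θ := by
        rw [mul_div_assoc', div_lt_iff₀ (by positivity)]
        nlinarith

theorem max_sub_two_mul_le (t : ℝ) {ε : ℝ} (hε : 0 < ε) :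
    max (t - 2 * ε) 0 ≤ (max (t - ε) 0 / ε) ^ 2 * (t - ε) := by
  rcases le_total t ε with htε | hεt
  · rw [max_eq_right (by linarith), max_eq_right (by linarith), zero_div]
    simp
  · rw [max_eq_left (sub_nonneg.2 hεt)]
    refine max_le ?_ (mul_nonneg (sq_nonneg _) (sub_nonneg.2 hεt))
    rw [div_pow, div_mul_eq_mul_div, le_div_iff₀ (by positivity)]
    nlinarith [mul_nonneg (sub_nonneg.2 hεt) (sq_nonneg (t - 2 * ε)), sq_nonneg (t - 2 * ε),
      mul_pos hε hε]

theorem exists_cutDown_le_compress {b p : Pos A} {ε : ℝ} (hε : 0 < ε)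
    (h : ‖(b : A) - p‖ ≤ ε) : ∃ x : A, (cutDown b (2 * ε) : A) ≤ compress x p := by
  have hb : IsSelfAdjoint (b : A) := .of_nonneg b.2
  set f : ℝ → ℝ := fun t => max (t - ε) 0 / ε with hf
  have hfc : Continuous f := by fun_prop
  have hf0 : f 0 = 0 := by simp [hf, hε.le]
  set k := cfcₙ f (b : A) with hk
  have hks : star k = k := (isSelfAdjoint_cfcₙ f (b : A)).star_eq
  have hperturb : k * (b - p) * k ≤ ε • (k * k) := by
    have hkk : 0 ≤ k * k := by simpa only [hks] using star_mul_self_nonneg k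
    have hconj := CStarAlgebra.star_left_conjugate_le_norm_smul (a := k)
      (hb.sub (.of_nonneg p.2) : IsSelfAdjoint ((b : A) - p))
    rw [hks] at hconj
    exact hconj.trans (smul_le_smul_of_nonneg_right h hkk)
  have hcutDown : (cutDown b (2 * ε) : A) ≤ k * b * k - ε • (k * k) := by
    have hkbk : k * b * k = cfcₙ (fun t => f t * t * f t) (b : A) := by
      rw [← cfcₙ_mul_mul_cfcₙ (b : A) hfc hf0 continuous_id' rfl, cfcₙ_id' ℝ (b : A) hb]
    rw [hkbk, hk,
      ← cfcₙ_mul f f (b : A) hfc.continuousOn hf0 hfc.continuousOn hf0,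
      ← cfcₙ_smul ε (fun t => f t * f t) (b : A) (by fun_prop) (by simp [hf0]),
      ← cfcₙ_sub (fun t => f t * t * f t) _ (b : A) (by fun_prop) (by simp) (by fun_prop)
        (by simp [hf0])]
    refine cfcₙ_mono (fun t _ => ?_) (by fun_prop) (by fun_prop) (by simp [hε.le])
      (by simp [hf0])
    rw [show f t * t * f t - ε • (f t * f t) = f t ^ 2 * (t - ε) by rw [smul_eq_mul]; ring]
    exact max_sub_two_mul_le t hε
  refine ⟨k, ?_⟩
  rw [mul_sub, sub_mul, sub_le_comm] at hperturb
  rw [coe_compress, hks]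
  exact hcutDown.trans hperturb

theorem LscTrace.cutDown_lt_top_of_mem_finiteIdeal {τ : LscTrace A} {b : Pos A}
    (hb : (b : A) ∈ τ.finiteIdeal) {ε : ℝ} (hε : 0 < ε) : τ (cutDown b ε) < ⊤ := by
  obtain ⟨x, -, rfl⟩ := exists_absSq_eq b
  have hx : x ∈ closure (τ.squareSummable : Set A) := τ.finiteIdeal.absSq_mem_iff.1 hb
  have hU : IsOpen {y : A | ‖(absSq x : A) - absSq y‖ < ε / 2} :=
    isOpen_lt (continuous_const.sub (continuous_subtype_val.comp continuous_absSq)).norm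
      continuous_const
  obtain ⟨y, hy, hyτ⟩ := mem_closure_iff.1 hx _ hU (by simpa using hε)
  obtain ⟨k, hk⟩ := exists_cutDown_le_compress (half_pos hε) (le_of_lt hy)
  rw [mul_div_cancel₀ _ two_ne_zero] at hk
  exact (τ.mono hk).trans_lt ((τ.map_compress_le k _).trans_lt
    (ENNReal.mul_lt_top (ENNReal.pow_lt_top enorm_lt_top) hyτ))

/-- The element `min(a, δ)`, i.e. the part of `a` that the cut-down `(a - δ)₊` removes. -/
def truncate (a : Pos A) (δ : ℝ≥0) : Pos A :=
  ⟨cfcₙ (fun t : ℝ => min t δ) (a : A), cfcₙ_nonneg fun t ht =>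
    le_min (quasispectrum_nonneg_of_nonneg _ a.2 t ht) δ.2⟩

theorem cutDown_add_truncate (a : Pos A) (δ : ℝ≥0) : cutDown a δ + truncate a δ = a := by
  apply Subtype.ext
  change cfcₙ (fun t : ℝ => max (t - δ) 0) (a : A) + cfcₙ (fun t : ℝ => min t δ) (a : A) = a
  rw [← cfcₙ_add (fun t : ℝ => max (t - δ) 0) (fun t : ℝ => min t δ) (a : A) (by fun_prop)
    (by simp) (by fun_prop) (by simp)]
  conv_rhs => rw [← cfcₙ_id' ℝ (a : A) (.of_nonneg a.2)]
  congr 1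
  funext t
  grind

theorem enorm_truncate_le (a : Pos A) (δ : ℝ≥0) : ‖(truncate a δ : A)‖ₑ ≤ δ := by
  refine ENNReal.coe_le_coe.2 (norm_cfcₙ_le fun t ht => ?_)
  have ht0 : 0 ≤ t := quasispectrum_nonneg_of_nonneg _ a.2 t ht
  exact (Real.norm_of_nonneg (le_min ht0 δ.2)).trans_le (min_le_right _ _)

theorem truncate_le (a : Pos A) (δ : ℝ≥0) : (truncate a δ : A) ≤ a := by
  conv_rhs => rw [← cutDown_add_truncate a δ]
  exact le_add_of_nonneg_left (cutDown a δ).2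

namespace LscTrace

variable (τ : LscTrace A)

/-- The least constant `M` with `τ (x* b x) ≤ ‖x* b x‖ M` for all `x`, i.e. the value of the
dimension function of `τ` at `b`. The term with `x* b x = 0` is `0 / 0 = 0`. -/
def dimension (b : Pos A) : ℝ≥0∞ := ⨆ x, τ (compress x b) / ‖(compress x b : A)‖ₑ

variable {τ}

theorem dimension_le_iff {b : Pos A} {M : ℝ≥0∞} :
    τ.dimension b ≤ M ↔ ∀ x, τ (compress x b) ≤ ‖(compress x b : A)‖ₑ * M := by
  refine iSup_le_iff.trans (forall_congr' fun x => ?_)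
  rcases eq_or_ne (compress x b) 0 with h | h
  · simp [h, τ.map_zero']
  · have h0 : ‖(compress x b : A)‖ₑ ≠ 0 := enorm_ne_zero.2 fun h' => h (Subtype.ext h')
    rw [ENNReal.div_le_iff h0 enorm_ne_top, mul_comm]

variable (τ)

theorem map_compress_le_enorm_mul_dimension (x : A) (b : Pos A) :
    τ (compress x b) ≤ ‖(compress x b : A)‖ₑ * τ.dimension b :=
  dimension_le_iff.1 le_rfl x

theorem map_le_enorm_mul_dimension_of_le {b s : Pos A} (h : (b : A) ≤ s) :
    τ b ≤ ‖(b : A)‖ₑ * τ.dimension s := by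
  refine closure_minimal ?_ (τ.lsc'.isClosed_preimage _) (mem_closure_compress_of_le h)
  rintro _ ⟨⟨x, rfl⟩, hx⟩
  refine (τ.map_compress_le_enorm_mul_dimension x s).trans ?_
  gcongr
  exact enorm_le_iff_norm_le.2 hx

theorem dimension_compress_le (x : A) (b : Pos A) :
    τ.dimension (compress x b) ≤ τ.dimension b :=
  dimension_le_iff.2 fun y => by
    rw [compress_compress]
    exact τ.map_compress_le_enorm_mul_dimension _ b

theorem dimension_mono {b c : Pos A} (h : (b : A) ≤ c) : τ.dimension b ≤ τ.dimension c :=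
  dimension_le_iff.2 fun x =>
    (τ.map_le_enorm_mul_dimension_of_le (compress_mono x h)).trans
      (by gcongr; exact τ.dimension_compress_le x c)

theorem dimension_zero : τ.dimension 0 = 0 := by
  simp [dimension, compress_zero, τ.map_zero']

theorem dimension_add_le (b c : Pos A) :
    τ.dimension (b + c) ≤ τ.dimension b + τ.dimension c := by
  refine dimension_le_iff.2 fun x => ?_
  have hb : (compress x b : A) ≤ compress x (b + c) :=
    compress_mono x (le_add_of_nonneg_right c.2)
  have hc : (compress x c : A) ≤ compress x (b + c) :=
    compress_mono x (le_add_of_nonneg_left b.2)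
  calc τ (compress x (b + c)) = τ (compress x b) + τ (compress x c) := by
        rw [compress_add, τ.map_add']
    _ ≤ ‖(compress x b : A)‖ₑ * τ.dimension b + ‖(compress x c : A)‖ₑ * τ.dimension c := by
        gcongr <;> exact τ.map_compress_le_enorm_mul_dimension x _
    _ ≤ ‖(compress x (b + c) : A)‖ₑ * (τ.dimension b + τ.dimension c) := by
        rw [mul_add]
        gcongr <;> refine enorm_le_iff_norm_le.2 (CStarAlgebra.norm_le_norm_of_nonneg_of_le ?_ ?_)
        exacts [(compress x b).2, hb, (compress x c).2, hc]

theorem dimension_absSq_smul_le (c : ℂ) (v : A) :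
    τ.dimension (absSq (c • v)) ≤ τ.dimension (absSq v) :=
  dimension_le_iff.2 fun x => by
    rw [compress_absSq, smul_mul_assoc, ← mul_smul_comm, ← compress_absSq]
    exact τ.map_compress_le_enorm_mul_dimension _ _

theorem dimension_absSq_le_of_mul_eq_self {e v : A} (h : e * v = v) :
    τ.dimension (absSq v) ≤ τ (absSq e) :=
  dimension_le_iff.2 fun x => by
    rw [compress_absSq, enorm_absSq]
    simpa only [← mul_assoc, h] using τ.map_absSq_mul_right_le e (v * x)

theorem dimension_absSq_cutDown_le (a : Pos A) {ε : ℝ} (hε : 0 < ε) :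
    τ.dimension (absSq (cutDown a ε : A)) ≤ ENNReal.ofReal (2 / ε) * τ (cutDown a (ε / 2)) := by
  set h : ℝ → ℝ := fun t => min 1 (2 / ε * max (t - ε / 2) 0) with hh
  have hhc : Continuous h := by fun_prop
  have hε2 : 0 ≤ ε / 2 := (half_pos hε).le
  have hh0 : h 0 = 0 := by simp [hh, hε2]
  set e := cfcₙ h (a : A)
  have he : star e = e := (isSelfAdjoint_cfcₙ h (a : A)).star_eq
  have hunit : e * cutDown a ε = cutDown a ε := by
    change cfcₙ h (a : A) * cfcₙ (fun t : ℝ => max (t - ε) 0) (a : A) = cfcₙ _ (a : A)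
    rw [← cfcₙ_mul h _ (a : A) hhc.continuousOn hh0 (by fun_prop) (by simp [hε.le])]
    congr 1
    funext t
    rcases le_total t ε with htε | hεt
    · rw [max_eq_right (sub_nonpos.2 htε), mul_zero]
    · have : 1 ≤ 2 / ε * max (t - ε / 2) 0 := by
        rw [div_mul_eq_mul_div, le_div_iff₀ hε]
        linarith [le_max_left (t - ε / 2) 0]
      rw [show h t = 1 from min_eq_left this, one_mul]
  have hdom : (absSq e : A) ≤ (2 / ε) • (cutDown a (ε / 2) : A) := by
    change star e * e ≤ (2 / ε) • cfcₙ (fun t : ℝ => max (t - ε / 2) 0) (a : A)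
    rw [he, ← cfcₙ_mul h h (a : A) hhc.continuousOn hh0 hhc.continuousOn hh0,
      ← cfcₙ_smul (2 / ε) (fun t : ℝ => max (t - ε / 2) 0) (a : A) (by fun_prop) (by simp [hε2])]
    refine cfcₙ_mono (fun t _ => ?_) (by fun_prop) (by fun_prop) (by simp [hh0]) (by simp [hε2])
    have ht : 0 ≤ h t := le_min zero_le_one (by positivity)
    exact (mul_le_of_le_one_left ht (min_le_left _ _)).trans (min_le_right _ _)
  refine (τ.dimension_absSq_le_of_mul_eq_self hunit).trans (τ.apply_le_of_le_smul _ ?_)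
  rwa [Real.coe_toNNReal _ (by positivity)]

end LscTrace

/-- A cone of positive elements invariant under compressions, whose span is a two-sided ideal.
Invariance under positive scalars is imposed in the form `|v|² ↦ |c v|²` with `c` complex. -/
structure IsInvariantCone (P : AddSubmonoid (Pos A)) : Prop where
  compress_mem : ∀ (x : A) {b : Pos A}, b ∈ P → compress x b ∈ P
  absSq_smul_mem : ∀ (c : ℂ) {v : A}, absSq v ∈ P → absSq (c • v) ∈ P

/-- The linear span of all products `x* y` with `x* x` and `y* y` in the cone `P`. -/
def productSpan (P : AddSubmonoid (Pos A)) : Submodule ℂ A :=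
  Submodule.span ℂ {z | ∃ x y : A, absSq x ∈ P ∧ absSq y ∈ P ∧ z = star x * y}

theorem mem_productSpan_of_mem {P : AddSubmonoid (Pos A)} {b : Pos A} (hb : b ∈ P) :
    (b : A) ∈ productSpan P := by
  obtain ⟨x, -, rfl⟩ := exists_absSq_eq b
  exact Submodule.subset_span ⟨x, x, hb, hb, coe_absSq x⟩

theorem productSpan_le {P : AddSubmonoid (Pos A)} {I : ClosedIdeal A}
    (hPI : ∀ b ∈ P, (b : A) ∈ I) : productSpan P ≤ I.toSubmodule := by
  refine Submodule.span_le.2 ?_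
  rintro z ⟨x, y, -, hy, rfl⟩
  exact I.mul_mem_left _ (I.absSq_mem_iff.1 (hPI _ hy))

namespace IsInvariantCone

variable {P : AddSubmonoid (Pos A)} (hP : IsInvariantCone P)

include hP

theorem mul_mem_productSpan (z : A) {w : A} (hw : w ∈ productSpan P) :
    z * w ∈ productSpan P ∧ w * z ∈ productSpan P := by
  have absSq_mul_mem {x : A} (y : A) (hx : absSq x ∈ P) : absSq (x * y) ∈ P :=
    compress_absSq y x ▸ hP.compress_mem y hx
  induction hw using Submodule.span_induction with
  | mem w hw =>
    obtain ⟨x, y, hx, hy, rfl⟩ := hw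
    refine ⟨Submodule.subset_span ⟨x * star z, y, absSq_mul_mem _ hx, hy, ?_⟩,
      Submodule.subset_span ⟨x, y * z, hx, absSq_mul_mem _ hy, mul_assoc _ _ _⟩⟩
    rw [star_mul, star_star, mul_assoc]
  | zero => simp
  | add x y _ _ hx hy =>
    rw [mul_add, add_mul]
    exact ⟨add_mem hx.1 hy.1, add_mem hx.2 hy.2⟩
  | smul c x _ hx =>
    rw [mul_smul_comm, smul_mul_assoc]
    exact ⟨Submodule.smul_mem _ _ hx.1, Submodule.smul_mem _ _ hx.2⟩

theorem exists_add_star_le_of_mem_productSpan {w : A} (hw : w ∈ productSpan P) (z : ℂ) :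
    ∃ s ∈ P, z • w + star (z • w) ≤ s := by
  induction hw using Submodule.span_induction generalizing z with
  | mem w hw =>
    obtain ⟨x, y, hx, hy, rfl⟩ := hw
    refine ⟨_, P.add_mem (hP.absSq_smul_mem (star z) hx) hy, ?_⟩
    set p := star z • x with hp
    have polarization : star p * p + star y * y - (star p * y + star (star p * y)) =
        star (p - y) * (p - y) := by
      rw [star_mul, star_star, star_sub]
      noncomm_ring
    rw [← smul_mul_assoc, ← star_star z, ← star_smul, ← hp]
    exact sub_nonneg.1 ((star_mul_self_nonneg (p - y)).trans_eq polarization.symm)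
  | zero => exact ⟨0, P.zero_mem, by simp⟩
  | add x y _ _ hx hy =>
    obtain ⟨s, hs, hxs⟩ := hx z
    obtain ⟨t, ht, hyt⟩ := hy z
    refine ⟨s + t, P.add_mem hs ht, ?_⟩
    rw [smul_add, star_add, add_add_add_comm]
    exact add_le_add hxs hyt
  | smul c x _ hx =>
    rw [smul_smul]
    exact hx _

/-- The closed ideal generated by the cone `P`. -/
def closedIdeal : ClosedIdeal A where
  toSubmodule := (productSpan P).topologicalClosure
  mul_mem_left' x _ hy := map_mem_closure (continuous_const_mul x) hy fun _ hz =>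
    (hP.mul_mem_productSpan x hz).1
  mul_mem_right' _ y hx := map_mem_closure (f := (· * y)) (continuous_mul_const y) hx fun _ hz =>
    (hP.mul_mem_productSpan y hz).2
  isClosed' := (productSpan P).isClosed_topologicalClosure

theorem mem_closedIdeal_of_mem {b : Pos A} (hb : b ∈ P) : (b : A) ∈ hP.closedIdeal :=
  subset_closure (mem_productSpan_of_mem hb)

theorem exists_le_of_mem_pedersen {I : ClosedIdeal A} (hPI : ∀ b ∈ P, (b : A) ∈ I)
    (hIP : ∀ x ∈ I, x ∈ hP.closedIdeal) {b : Pos A} (hb : (b : A) ∈ I.pedersen) :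
    ∃ s ∈ P, (b : A) ≤ s := by
  have pedersen_le : I.pedersen ≤ productSpan P :=
    sInf_le ⟨productSpan_le hPI, hIP, fun x _ _ => hP.mul_mem_productSpan x⟩
  obtain ⟨s, hs, hbs⟩ := hP.exists_add_star_le_of_mem_productSpan (pedersen_le hb) (1 / 2)
  have half_add_star_half : (1 / 2 + star (1 / 2) : ℂ) = 1 := by
    rw [star_div₀, star_one, star_ofNat, add_halves]
  rw [star_smul, (IsSelfAdjoint.of_nonneg b.2).star_eq, ← add_smul, half_add_star_half,
    one_smul] at hbs
  exact ⟨s, hs, hbs⟩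

end IsInvariantCone

/-- The cone of all `s` whose dimension `d_τ(s)` is bounded by a multiple of `τ ((a - ε)₊)`, for
some fixed `ε > 0` and uniformly in the trace `τ`. -/
def dominatedCone (a : Pos A) : AddSubmonoid (Pos A) where
  carrier := {s | ∃ C : ℝ≥0, ∃ ε > 0, ∀ τ : LscTrace A, τ.dimension s ≤ C * τ (cutDown a ε)}
  zero_mem' := ⟨0, 1, one_pos, fun τ => by simp [τ.dimension_zero]⟩
  add_mem' {s t} := by
    rintro ⟨C, ε, hε, hs⟩ ⟨D, θ, hθ, ht⟩
    refine ⟨C + D, min ε θ, lt_min hε hθ, fun τ => ?_⟩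
    have hmin : 0 ≤ min ε θ := (lt_min hε hθ).le
    have hCε : τ.dimension s ≤ C * τ (cutDown a (min ε θ)) := (hs τ).trans
      (by gcongr; exact τ.mono (cutDown_le_cutDown a hmin (min_le_left ε θ)))
    have hDθ : τ.dimension t ≤ D * τ (cutDown a (min ε θ)) := (ht τ).trans
      (by gcongr; exact τ.mono (cutDown_le_cutDown a hmin (min_le_right ε θ)))
    rw [ENNReal.coe_add, add_mul]
    exact (τ.dimension_add_le s t).trans (add_le_add hCε hDθ)

theorem mem_dominatedCone_of_dimension_le {a s t : Pos A}
    (h : ∀ τ : LscTrace A, τ.dimension t ≤ τ.dimension s) (hs : s ∈ dominatedCone a) :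
    t ∈ dominatedCone a := by
  obtain ⟨C, ε, hε, hC⟩ := hs
  exact ⟨C, ε, hε, fun τ => (h τ).trans (hC τ)⟩

theorem isInvariantCone_dominatedCone (a : Pos A) : IsInvariantCone (dominatedCone a) where
  compress_mem x b := mem_dominatedCone_of_dimension_le fun τ => τ.dimension_compress_le x b
  absSq_smul_mem c v := mem_dominatedCone_of_dimension_le fun τ => τ.dimension_absSq_smul_le c v

theorem absSq_cutDown_mem_dominatedCone (a : Pos A) {ε : ℝ} (hε : 0 < ε) :
    absSq (cutDown a ε : A) ∈ dominatedCone a :=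
  ⟨(2 / ε).toNNReal, ε / 2, half_pos hε, fun τ => τ.dimension_absSq_cutDown_le a hε⟩

theorem mem_generatedBy_of_mem_dominatedCone {a s : Pos A} (hs : s ∈ dominatedCone a) :
    (s : A) ∈ ClosedIdeal.generatedBy (a : A) := by
  obtain ⟨C, ε, hε, hC⟩ := hs
  set τ := idealTrace (ClosedIdeal.generatedBy (a : A))
  have hcut : τ (cutDown a ε) = 0 :=
    idealTrace_of_mem (ClosedIdeal.cutDown_mem _ (ClosedIdeal.mem_generatedBy _) hε.le)
  have hdim : τ.dimension s = 0 := le_zero_iff.1 ((hC τ).trans_eq (by rw [hcut, mul_zero]))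
  have hτs : τ s ≤ 0 :=
    (τ.map_le_enorm_mul_dimension_of_le le_rfl).trans_eq (by rw [hdim, mul_zero])
  by_contra h
  exact absurd hτs (by simp [τ, idealTrace_of_notMem h])

theorem mem_dominatedCone_of_mem_pedersen {a b : Pos A}
    (hb : (b : A) ∈ (ClosedIdeal.generatedBy (a : A)).pedersen) : b ∈ dominatedCone a := by
  have hP := isInvariantCone_dominatedCone a
  have generator_mem : (a : A) ∈ hP.closedIdeal :=
    hP.closedIdeal.mem_of_forall_cutDown_mem fun ε hε =>
      hP.closedIdeal.absSq_mem_iff.1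
        (hP.mem_closedIdeal_of_mem (absSq_cutDown_mem_dominatedCone a hε))
  obtain ⟨s, hs, hbs⟩ := hP.exists_le_of_mem_pedersen
    (fun _ => mem_generatedBy_of_mem_dominatedCone)
    (fun _ => ClosedIdeal.generatedBy_le generator_mem) hb
  exact mem_dominatedCone_of_dimension_le (fun τ => τ.dimension_mono hbs) hs

theorem exists_le_mul_cutDown_of_mem_pedersen {a : Pos A}
    (ha : (a : A) ∈ (ClosedIdeal.generatedBy (a : A)).pedersen) :
    ∃ C : ℝ≥0, ∃ ε > 0, ∀ δ : ℝ≥0, δ ≤ ε → ∀ τ : LscTrace A,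
      τ a ≤ (1 + C * δ) * τ (cutDown a δ) := by
  obtain ⟨C, ε, hε, hC⟩ := mem_dominatedCone_of_mem_pedersen ha
  refine ⟨C, ε.toNNReal, Real.toNNReal_pos.2 hε, fun δ hδ τ => ?_⟩
  have hδε : (δ : ℝ) ≤ ε := (Real.le_toNNReal_iff_coe_le hε.le).1 hδ
  have htruncate : τ (truncate a δ) ≤ C * δ * τ (cutDown a δ) :=
    calc τ (truncate a δ) ≤ ‖(truncate a δ : A)‖ₑ * τ.dimension a :=
          τ.map_le_enorm_mul_dimension_of_le (truncate_le a δ)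
      _ ≤ δ * (C * τ (cutDown a ε)) := by
          gcongr
          exacts [enorm_truncate_le a δ, hC τ]
      _ ≤ C * δ * τ (cutDown a δ) := by
          rw [mul_left_comm, mul_assoc]
          gcongr
          exact τ.mono (cutDown_le_cutDown a δ.2 hδε)
  calc τ a = τ (cutDown a δ) + τ (truncate a δ) := by rw [← τ.map_add', cutDown_add_truncate]
    _ ≤ τ (cutDown a δ) + C * δ * τ (cutDown a δ) := by gcongr
    _ = (1 + C * δ) * τ (cutDown a δ) := by rw [add_mul, one_mul]

theorem continuous_evalFunctional {a : Pos A}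
    (ha : (a : A) ∈ (ClosedIdeal.generatedBy (a : A)).pedersen) :
    Continuous (evalFunctional a) := by
  obtain ⟨C, ε, hε, hC⟩ := exists_le_mul_cutDown_of_mem_pedersen ha
  refine continuous_iff_continuousAt.2 fun τ => ?_
  have interval := tendsto_interval_iff.1 (Filter.tendsto_id (x := 𝓝 τ)) a
  refine tendsto_of_le_liminf_of_limsup_le (interval 1 one_pos).2 ?_
  have limsup_le {δ : ℝ≥0} (hδ : 0 < δ) (hδε : δ ≤ ε) :
      Filter.limsup (evalFunctional a) (𝓝 τ) ≤ (1 + C * δ) * τ a :=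
    calc Filter.limsup (evalFunctional a) (𝓝 τ)
        ≤ Filter.limsup (fun σ : LscTrace A => (1 + C * δ) * σ (cutDown a δ)) (𝓝 τ) :=
          Filter.limsup_le_limsup (.of_forall (hC δ hδε))
      _ = (1 + C * δ) * Filter.limsup (fun σ : LscTrace A => σ (cutDown a δ)) (𝓝 τ) :=
          ENNReal.limsup_const_mul_of_ne_top (by finiteness)
      _ ≤ (1 + C * δ) * τ a := by
          gcongr
          exact (interval δ hδ).1
  have tendsto_bound : Filter.Tendsto (fun δ : ℝ≥0 => (1 + C * (δ : ℝ≥0∞)) * τ a) (𝓝[>] 0)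
      (𝓝 (τ a)) := by
    have hfactor : Filter.Tendsto (fun δ : ℝ≥0 => ((1 + C * δ : ℝ≥0) : ℝ≥0∞)) (𝓝[>] 0) (𝓝 1) :=
      ((Continuous.tendsto' (by fun_prop) 0 1 (by simp)).mono_left nhdsWithin_le_nhds)
    simpa using ENNReal.Tendsto.mul_const hfactor (.inl one_ne_zero)
  refine ge_of_tendsto tendsto_bound ?_
  filter_upwards [Ioc_mem_nhdsGT hε] with δ hδ using limsup_le hδ.1 hδ.2

theorem tendsto_inv_nat_add_one_mul_of_ne_top {x : ℝ≥0∞} (hx : x ≠ ⊤) :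
    Filter.Tendsto (fun n : ℕ => (((n : ℝ≥0) + 1)⁻¹ : ℝ≥0) * x) Filter.atTop (𝓝 0) := by
  have hlim : Filter.Tendsto (fun n : ℕ => ((n : ℝ≥0) + 1)⁻¹) Filter.atTop (𝓝 0) := by
    simpa using tendsto_one_div_add_atTop_nhds_zero_nat (𝕜 := ℝ≥0)
  simpa using ENNReal.Tendsto.mul_const (ENNReal.tendsto_coe.2 hlim) (Or.inr hx)

theorem inv_nat_add_one_mul_top (n : ℕ) : (((n : ℝ≥0) + 1)⁻¹ : ℝ≥0) * (⊤ : ℝ≥0∞) = ⊤ :=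
  ENNReal.mul_top (ENNReal.coe_ne_zero.2 (by positivity))

theorem LscTrace.tendsto_smul_idealTrace_finiteIdeal (τ : LscTrace A) :
    Filter.Tendsto (fun n : ℕ => ((n : ℝ≥0) + 1)⁻¹ • τ) Filter.atTop
      (𝓝 (idealTrace τ.finiteIdeal)) := by
  refine tendsto_interval_iff.2 fun b ε hε => ?_
  simp only [LscTrace.smul_apply]
  by_cases hb : (b : A) ∈ τ.finiteIdeal
  · have hlim := tendsto_inv_nat_add_one_mul_of_ne_top (cutDown_lt_top_of_mem_finiteIdeal hb hε).ne
    rw [idealTrace_of_mem hb, hlim.limsup_eq]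
    exact ⟨le_rfl, zero_le⟩
  · have hτ : τ b = ⊤ := not_lt_top_iff.1 fun h => hb (mem_finiteIdeal_of_lt_top h)
    simp only [idealTrace_of_notMem hb, hτ, inv_nat_add_one_mul_top, Filter.liminf_const, le_top,
      le_refl, and_self]

theorem add_idealTrace_mem_supportCone {τ : LscTrace A} {I : ClosedIdeal A}
    (h : idealTrace τ.finiteIdeal ≤ idealTrace I) : τ + idealTrace I ∈ supportCone I := by
  refine LscTrace.mem_supportCone_iff.2 (ClosedIdeal.ext_of_forall_nonneg fun b =>
    ⟨fun hb => ClosedIdeal.mem_of_forall_cutDown_mem _ fun ε hε =>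
      LscTrace.mem_finiteIdeal_of_lt_top ?_, ?_⟩)
  · have hfin : τ (cutDown b ε) < ⊤ :=
      LscTrace.cutDown_lt_top_of_mem_finiteIdeal (idealTrace_le_idealTrace_iff.1 h b hb) hε
    rwa [LscTrace.add_apply, idealTrace_of_mem (I.cutDown_mem hb hε.le), add_zero]
  · have hle : idealTrace I ≤ τ + idealTrace I := fun _ => le_add_self
    exact idealTrace_le_idealTrace_iff.1
      ((τ + idealTrace I).isLUB_idealTrace_finiteIdeal.1 ⟨idealTrace_add_self I, hle⟩) b

namespace LscFunctional

variable (g : LscFunctional A)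

open Classical in
/-- The functional `∞ · g`, with value `0` where `g` vanishes and `∞` elsewhere. -/
def topMul : LscFunctional A where
  toFun τ := if g τ = 0 then 0 else ⊤
  map_zero' := if_pos g.map_zero'
  map_add' σ τ := by
    by_cases hσ : g σ = 0 <;> by_cases hτ : g τ = 0 <;> simp [g.map_add', hσ, hτ]
  map_smul' r τ hr := by
    by_cases hτ : g τ = 0
    · simp [g.map_smul' r τ hr, hτ]
    · simp [g.map_smul' r τ hr, hτ, hr.ne', ENNReal.mul_top]
  lsc' τ r hr := by
    dsimp only at hr
    split_ifs at hr with hτ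
    · exact absurd hr not_lt_zero
    · filter_upwards [g.lsc' τ 0 (pos_iff_ne_zero.2 hτ)] with σ hσ
      simpa only [if_neg hσ.ne'] using hr

theorem isLeast_topMul :
    IsLeast {e : LscFunctional A | (∀ τ, e τ + e τ = e τ) ∧ g ≤ e} g.topMul := by
  refine ⟨⟨fun τ => ?_, fun τ => ?_⟩, ?_⟩
  · by_cases hτ : g τ = 0 <;> simp [topMul, hτ]
  · by_cases hτ : g τ = 0 <;> simp [topMul, hτ]
  · rintro e ⟨he, hge⟩ τ
    rcases eq_zero_or_eq_top_of_add_self_eq (he τ) with heτ | heτ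
    · have hgτ : g τ = 0 := le_zero_iff.1 ((hge τ).trans_eq heτ)
      exact (if_pos hgτ).trans_le zero_le
    · exact le_top.trans_eq heτ.symm

variable {g} {I : ClosedIdeal A}

theorem hasSupportIdeal_iff : g.HasSupportIdeal I ↔ ∀ τ, g τ = 0 ↔ τ ≤ idealTrace I := by
  have topMul_eq_iff : g.topMul = idealFunctional I ↔ ∀ τ, g τ = 0 ↔ τ ≤ idealTrace I := by
    rw [LscFunctional.ext_iff]
    refine forall_congr' fun τ => ?_
    by_cases hg : g τ = 0 <;> by_cases hτ : τ ≤ idealTrace I <;>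
      simp [topMul, idealFunctional, hg, hτ]
  rw [← topMul_eq_iff, HasSupportIdeal]
  exact ⟨g.isLeast_topMul.isGLB.unique, fun h => h ▸ g.isLeast_topMul.isGLB⟩

theorem apply_lt_top_iff (hc : Continuous g) {τ : LscTrace A} :
    g τ < ⊤ ↔ g (idealTrace τ.finiteIdeal) = 0 := by
  have hlim : Filter.Tendsto (fun n : ℕ => (((n : ℝ≥0) + 1)⁻¹ : ℝ≥0) * g τ) Filter.atTop
      (𝓝 (g (idealTrace τ.finiteIdeal))) := by
    have := (hc.tendsto _).comp τ.tendsto_smul_idealTrace_finiteIdeal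
    exact this.congr fun n => g.map_smul' _ τ (by positivity)
  refine ⟨fun h => tendsto_nhds_unique hlim (tendsto_inv_nat_add_one_mul_of_ne_top h.ne),
    fun h => ?_⟩
  by_contra htop
  simp only [not_lt_top_iff.1 htop, inv_nat_add_one_mul_top, h] at hlim
  exact ENNReal.top_ne_zero (tendsto_nhds_unique tendsto_const_nhds hlim)

namespace HasSupportIdeal

variable (hI : g.HasSupportIdeal I)

include hI

theorem apply_idealTrace : g (idealTrace I) = 0 := (hasSupportIdeal_iff.1 hI _).2 le_rfl

theorem apply_lt_top_of_mem_supportCone (hc : Continuous g) {τ : LscTrace A}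
    (hτ : τ ∈ supportCone I) : g τ < ⊤ := by
  rw [apply_lt_top_iff hc, ← LscTrace.mem_supportCone_iff.1 hτ]
  exact hI.apply_idealTrace

theorem preimage_zero : (fun τ : supportCone I => g τ) ⁻¹' {0} =
    {⟨idealTrace I, idealTrace_mem_supportCone I⟩} := by
  ext ⟨τ, hτ⟩
  have hle : idealTrace I ≤ τ :=
    (LscTrace.mem_supportCone_iff.1 hτ) ▸ τ.idealTrace_finiteIdeal_le
  rw [Set.mem_singleton_iff, Subtype.mk.injEq]
  exact (hasSupportIdeal_iff.1 hI τ).trans hle.ge_iff_eq'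

theorem extend_restrict (hc : Continuous g) (τ : LscTrace A) :
    extend I (fun σ : supportCone I => g σ) τ = g τ := by
  unfold extend
  split_ifs with h
  · exact (g.map_add' _ _).trans (by rw [hI.apply_idealTrace, add_zero])
  · refine (not_lt_top_iff.1 fun hτ => h (add_idealTrace_mem_supportCone ?_)).symm
    exact (hasSupportIdeal_iff.1 hI _).1 ((apply_lt_top_iff hc).1 hτ)

end HasSupportIdeal

end LscFunctional

theorem hasSupportIdeal_evalFunctional (a : Pos A) :
    (evalFunctional a).HasSupportIdeal (ClosedIdeal.generatedBy (a : A)) :=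
  LscFunctional.hasSupportIdeal_iff.2 fun _ => LscTrace.le_idealTrace_generatedBy_iff.symm

end TraceCone

end

theorem mainTheorem10 {A : Type*} [NonUnitalCStarAlgebra A] [PartialOrder A] [StarOrderedRing A]
    (a : Pos A) (I : ClosedIdeal A) (hI : I = ClosedIdeal.generatedBy (a : A))
    (ha : (a : A) ∈ I.pedersen) :
    -- the restriction of `ā` to `T_I(A)` is continuous, finite, and vanishes only at `τ_I`
    Continuous (fun τ : supportCone I => evalFunctional a τ) ∧
    (∀ τ : supportCone I, evalFunctional a τ < ⊤) ∧
    (fun τ : supportCone I => evalFunctional a τ) ⁻¹' {0} =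
      {⟨idealTrace I, idealTrace_mem_supportCone I⟩} ∧
    -- its canonical extension to `T(A)` coincides with `ā`
    (∀ τ : LscTrace A, extend I (fun σ : supportCone I => evalFunctional a σ) τ =
      evalFunctional a τ) ∧
    -- `ā` is the unique extension to a continuous cone morphism on `T(A)` with support ideal `I`
    Continuous (evalFunctional a) ∧
    (evalFunctional a).HasSupportIdeal I ∧
    ∀ g : LscFunctional A, Continuous g → g.HasSupportIdeal I →
      (∀ τ : supportCone I, g τ = evalFunctional a τ) → g = evalFunctional a := by
  subst hI
  have hcont := continuous_evalFunctional ha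
  have hsupp := hasSupportIdeal_evalFunctional a
  refine ⟨hcont.comp continuous_subtype_val,
    fun τ => hsupp.apply_lt_top_of_mem_supportCone hcont τ.2, hsupp.preimage_zero,
    hsupp.extend_restrict hcont, hcont, hsupp, fun g hg hgI hga => LscFunctional.ext fun τ => ?_⟩
  rw [← hgI.extend_restrict hg, funext hga, hsupp.extend_restrict hcont]
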